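/- Let $\mathcal H$ be an infinite-dimensional complex Hilbert space and let $\mathcal A\subseteq B(\mathcal H)$ be a norm-closed unital subalgebra. Write $\mathbb T_n(\mathcal A)$ for the upper triangular $n\times n$ matrices with entries in $\mathcal A$, acting on the $n$-fold Hilbert space direct sum $\mathcal H^{(n)}$, and assume that for every $n\ge 1$ there is a unitary $U_n:\mathcal H^{(n)}\to\mathcal H$ with $U_n\,\mathbb T_n(\mathcal A)\,U_n^*\subseteq\mathcal A$. Let $d\ge 1$, and give $\mathcal A^d$ the norm topology. A set $\Omega\subseteq\mathcal A^d$ is an NC domain if it is open, bounded, and for each $n\ge 2$ there is a unitary $U_n:\mathcal H^{(n)}\to\mathcal H$ with $U_n\,\mathbb T_n(\mathcal A)\,U_n^*\subseteq\mathcal A$ such that $U_n(x_1\oplus\cdots\oplus x_n)U_n^*\in\Omega$ (coordinatewise) whenever $x_1,\dots,x_n\in\Omega$. It is balanced if $\alpha\Omega\subseteq\Omega$ for all $\alpha\in\mathbb C$ with $|\alpha|\le 1$. A function $F:\Omega\to B(\mathcal H)$ is NC if it is locally bounded on $\Omega$ and $LF(x)=F(y)L$ whenever $x,y\in\Omega$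 and $L\in B(\mathcal H)$ satisfy $Lx^r=y^rL$ for $r=1,\dots,d$. A free polynomial is an element of the free algebra over $\mathbb C$ in $d$ non-commuting variables; it is homogeneous of degree $k$ if it is a linear combination of words of length $k$ (so $0$ is homogeneous of every degree). **Theorem.** Let $\Omega\subseteq\mathcal A^d$ be a balanced NC domain and let $F:\Omega\to B(\mathcal H)$. The following are equivalent. (i) $F$ is NC. (ii) There are free polynomials $p_k$, $k\ge 0$, with $p_k$ homogeneous of degree $k$, such that for every $x\in\Omega$ one has $\sum_k\|p_k(x)\|<\infty$ and $\sum_{k=0}^\infty p_k(x)=F(x)$, and $x$ has a neighbourhood in $\Omega$ on which the partial sums of $\sum_k p_k$ converge to $F$ uniformly in operator norm. (iii) For every $x_1,x_2,x_3\in\Omega$ there is a sequence of free polynomials that converges to $F$, uniformly in operator norm, on some neighbourhood of each of $x_1,x_2,x_3$. -/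

import Mathlib

open Topology Filter

noncomputable section

namespace NCFun

variable {H : Type*} [NormedAddCommGroup H] [InnerProductSpace ℂ H]

/-- The bounded operator on the Hilbert space direct sum `H ⊕ ⋯ ⊕ H` (`n` summands) given by an
`n × n` matrix of bounded operators on `H`. -/
def blockOp {n : ℕ} (M : Matrix (Fin n) (Fin n) (H →L[ℂ] H)) :
    PiLp 2 (fun _ : Fin n => H) →L[ℂ] PiLp 2 (fun _ : Fin n => H) :=
  ((PiLp.continuousLinearEquiv 2 ℂ (fun _ : Fin n => H)).symm :
      (Fin n → H) →L[ℂ] PiLp 2 (fun _ : Fin n => H)) ∘L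
    ContinuousLinearMap.pi (fun i => ∑ j, M i j ∘L PiLp.proj 2 (fun _ : Fin n => H) j)

theorem blockOp_apply {n : ℕ} (M : Matrix (Fin n) (Fin n) (H →L[ℂ] H))
    (v : PiLp 2 (fun _ : Fin n => H)) (i : Fin n) :
    blockOp M v i = ∑ j, M i j (v j) := by
  simp [blockOp]

/-- The operator `U M U*` on `H`, for a unitary `U : H ⊕ ⋯ ⊕ H → H` and an operator matrix `M`. -/
def unitaryConj {n : ℕ} (U : PiLp 2 (fun _ : Fin n => H) ≃ₗᵢ[ℂ] H)
    (M : Matrix (Fin n) (Fin n) (H →L[ℂ] H)) : H →L[ℂ] H :=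
  (U.toContinuousLinearEquiv : PiLp 2 (fun _ : Fin n => H) →L[ℂ] H) ∘L blockOp M ∘L
    (U.symm.toContinuousLinearEquiv : H →L[ℂ] PiLp 2 (fun _ : Fin n => H))

/-- `U 𝕋ₙ(A) U* ⊆ A`, where `𝕋ₙ(A)` is the set of upper triangular `n × n` matrices with entries
in `A`. -/
def MapsTriangular {n : ℕ} (A : Subalgebra ℂ (H →L[ℂ] H))
    (U : PiLp 2 (fun _ : Fin n => H) ≃ₗᵢ[ℂ] H) : Prop :=
  ∀ M : Matrix (Fin n) (Fin n) (H →L[ℂ] H),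
    (∀ i j, M i j ∈ A) → M.BlockTriangular id → unitaryConj U M ∈ A

/-- The direct sum property of the algebra `A`. -/
def HasDirectSumProperty (A : Subalgebra ℂ (H →L[ℂ] H)) : Prop :=
  ∀ n : ℕ, 1 ≤ n → ∃ U : PiLp 2 (fun _ : Fin n => H) ≃ₗᵢ[ℂ] H, MapsTriangular A U

/-- NC domains in `A ^ d`: open bounded sets closed under finite direct sums, the direct sum being
formed with unitaries `Uₙ` that realise the direct sum property of `A`. -/
structure IsNCDomain {d : ℕ} (A : Subalgebra ℂ (H →L[ℂ] H)) (Ω : Set (Fin d → A)) : Prop where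
  isOpen : IsOpen Ω
  isBounded : Bornology.IsBounded Ω
  directSum : ∀ n : ℕ, 2 ≤ n → ∃ U : PiLp 2 (fun _ : Fin n => H) ≃ₗᵢ[ℂ] H,
    MapsTriangular A U ∧
    ∀ x : Fin n → Fin d → A, (∀ j, x j ∈ Ω) →
      ∃ y ∈ Ω, ∀ r : Fin d,
        (y r : H →L[ℂ] H) = unitaryConj U (Matrix.diagonal fun j => (x j r : H →L[ℂ] H))

/-- `F` preserves intertwinings between points of `Ω`. -/
def IntertwiningPreserving {d : ℕ} {A : Subalgebra ℂ (H →L[ℂ] H)} (Ω : Set (Fin d → A))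
    (F : Ω → (H →L[ℂ] H)) : Prop :=
  ∀ x y : Ω, ∀ L : H →L[ℂ] H,
    (∀ r : Fin d, L ∘L (x.1 r : H →L[ℂ] H) = (y.1 r : H →L[ℂ] H) ∘L L) → L ∘L F x = F y ∘L L

/-- NC functions on `Ω`: intertwining preserving and locally bounded. -/
structure IsNCFunction {d : ℕ} {A : Subalgebra ℂ (H →L[ℂ] H)} (Ω : Set (Fin d → A))
    (F : Ω → (H →L[ℂ] H)) : Prop where
  intertwining : IntertwiningPreserving Ω F
  locallyBounded : ∀ x : Ω, ∃ V ∈ 𝓝 x, ∃ C : ℝ, ∀ y ∈ V, ‖F y‖ ≤ C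

/-- The value of a free polynomial in `d` variables at a point of `A ^ d`, as an operator. -/
def evalPoly {d : ℕ} {A : Subalgebra ℂ (H →L[ℂ] H)} (p : FreeAlgebra ℂ (Fin d))
    (x : Fin d → A) : H →L[ℂ] H :=
  (FreeAlgebra.lift ℂ x p : A)

/-- Homogeneous free polynomials of degree `k` (zero included): linear combinations of words of
length `k` in the variables. -/
def IsHomogeneousFree {d : ℕ} (k : ℕ) (p : FreeAlgebra ℂ (Fin d)) : Prop :=
  p ∈ Submodule.span ℂ
    (Set.range fun w : Fin k → Fin d => (List.ofFn fun i => FreeAlgebra.ι ℂ (w i)).prod)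

end NCFun

end

/-! Block matrices supply enough intertwiners to force polynomial behaviour. Let z be bidiagonal,
with x on the superdiagonal and t x in the last corner. The column (1, t, ..., tⁿ) intertwines t x
with z, so F(t x) = Σ tⁱ F(z)₀ᵢ. For k < n the entry F(z)₀ₖ is a homogeneous polynomial p_k(x),
independent of n and t: another intertwiner links z to scaled creation operators on words of length
at most k, where the blocks of the value of F commute with every operator and so are scalars
(`exists_homogeneous_component`). Since F is bounded near 0, the last term is O(tⁿ), and Σ p_k = F
near 0 (`exists_hasSum_evalPoly_near_zero`).

To reach all of Ω, note that F at [a, τ(c - a); 0, c] has corner τ(F(c) - F(a)). Local boundedness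
therefore gives continuity, and continuity makes t ↦ F(t x) complex differentiable. As Ω is open and
balanced, this holds on a disc of radius R > 1. The Taylor coefficients are p_k(x), and Cauchy's
estimates, uniform near x, give (ii).

Partial sums give (iii). Polynomials preserve intertwinings, and this survives limits along one
sequence converging at both points, whence (i). -/

noncomputable section

namespace NCFun

/-! ### Block matrices over a ring -/

/-- A family of "column" and "row" elements of a ring that identifies the ring with matrices over
itself. -/
structure BlockSystem (ι R : Type*) [Fintype ι] [DecidableEq ι] [Ring R] where
  col : ι → R
  row : ι → R
  row_mul_col : ∀ i j, row i * col j = if i = j then 1 else 0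
  sum_col_mul_row : ∑ i, col i * row i = 1

namespace BlockSystem

variable {ι κ μ R : Type*} [Fintype ι] [DecidableEq ι] [Fintype κ] [DecidableEq κ]
  [Fintype μ] [DecidableEq μ] [Ring R]

/-- The element of the ring with the given matrix of blocks. -/
def assemble (E : BlockSystem ι R) (E' : BlockSystem κ R) (K : Matrix ι κ R) : R :=
  ∑ i, ∑ j, E.col i * K i j * E'.row j

/-- The matrix of blocks of an element of the ring. -/
def blocks (E : BlockSystem ι R) (E' : BlockSystem κ R) (a : R) : Matrix ι κ R :=
  Matrix.of fun i j => E.row i * a * E'.col j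

theorem blocks_apply (E : BlockSystem ι R) (E' : BlockSystem κ R) (a : R) (i : ι) (j : κ) :
    E.blocks E' a i j = E.row i * a * E'.col j := rfl

theorem blocks_mul (E : BlockSystem ι R) (E' : BlockSystem κ R) (E'' : BlockSystem μ R)
    (a b : R) : E.blocks E'' (a * b) = E.blocks E' a * E'.blocks E'' b := by
  ext i j
  simp only [Matrix.mul_apply, blocks_apply]
  calc E.row i * (a * b) * E''.col j
      = E.row i * a * (∑ k, E'.col k * E'.row k) * (b * E''.col j) := by
        rw [E'.sum_col_mul_row]; simp only [mul_assoc, one_mul]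
    _ = _ := by simp only [Finset.mul_sum, Finset.sum_mul, mul_assoc]

theorem blocks_assemble (E : BlockSystem ι R) (E' : BlockSystem κ R) (K : Matrix ι κ R) :
    E.blocks E' (E.assemble E' K) = K := by
  ext i j
  simp only [blocks_apply, assemble, Finset.mul_sum, Finset.sum_mul]
  have h : ∀ a b, E.row i * (E.col a * K a b * E'.row b) * E'.col j
      = if i = a then (if b = j then K a b else 0) else 0 := by
    intro a b
    rw [show E.row i * (E.col a * K a b * E'.row b) * E'.col j
      = (E.row i * E.col a) * K a b * (E'.row b * E'.col j) by simp only [mul_assoc],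
      E.row_mul_col, E'.row_mul_col]
    split_ifs <;> simp
  simp [h]

theorem assemble_blocks (E : BlockSystem ι R) (E' : BlockSystem κ R) (a : R) :
    E.assemble E' (E.blocks E' a) = a := by
  simp only [blocks_apply, assemble]
  calc ∑ i, ∑ j, E.col i * (E.row i * a * E'.col j) * E'.row j
      = (∑ i, E.col i * E.row i) * a * (∑ j, E'.col j * E'.row j) := by
        simp only [Finset.mul_sum, Finset.sum_mul, mul_assoc]
        exact Finset.sum_comm
    _ = a := by rw [E.sum_col_mul_row, E'.sum_col_mul_row, one_mul, mul_one]

theorem assemble_mul (E : BlockSystem ι R) (E' : BlockSystem κ R) (E'' : BlockSystem μ R)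
    (K : Matrix ι κ R) (L : Matrix κ μ R) :
    E.assemble E' K * E'.assemble E'' L = E.assemble E'' (K * L) := by
  rw [← E.assemble_blocks E'' (_ * _), E.blocks_mul E' E'', blocks_assemble, blocks_assemble]

/-- The system with a single block. -/
def trivial (R : Type*) [Ring R] : BlockSystem Unit R where
  col _ := 1
  row _ := 1
  row_mul_col := by simp
  sum_col_mul_row := by simp

theorem assemble_trivial (M : Matrix Unit Unit R) :
    (trivial R).assemble (trivial R) M = M () () := by
  simp [assemble, trivial]

theorem blocks_trivial (a : R) : (trivial R).blocks (trivial R) a () () = a := by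
  simp [blocks_apply, trivial]

/-- Relabelling the blocks. -/
def reindex (E : BlockSystem ι R) (e : ι ≃ κ) : BlockSystem κ R where
  col k := E.col (e.symm k)
  row k := E.row (e.symm k)
  row_mul_col i j := by simp [E.row_mul_col]
  sum_col_mul_row := by
    rw [e.symm.sum_comp (fun i => E.col i * E.row i), E.sum_col_mul_row]

theorem assemble_reindex (E : BlockSystem ι R) (e : ι ≃ κ) (M : Matrix κ κ R) :
    (E.reindex e).assemble (E.reindex e) M = E.assemble E (M.submatrix e e) := by
  simp only [assemble, reindex, Matrix.submatrix_apply]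
  rw [← e.sum_comp]
  refine Finset.sum_congr rfl fun i _ => ?_
  rw [← e.sum_comp]
  simp

end BlockSystem

/-! ### Blocks of operators given by unitaries -/

variable {H : Type*} [NormedAddCommGroup H] [InnerProductSpace ℂ H]

/-- The block system of a unitary `H ⊕ ⋯ ⊕ H → H`. -/
def unitaryBlocks {n : ℕ} (U : PiLp 2 (fun _ : Fin n => H) ≃ₗᵢ[ℂ] H) :
    BlockSystem (Fin n) (H →L[ℂ] H) where
  col i := (U.toContinuousLinearEquiv : PiLp 2 (fun _ : Fin n => H) →L[ℂ] H) ∘L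
    ((PiLp.continuousLinearEquiv 2 ℂ (fun _ : Fin n => H)).symm :
      (Fin n → H) →L[ℂ] PiLp 2 (fun _ : Fin n => H)) ∘L
    ContinuousLinearMap.single ℂ (fun _ : Fin n => H) i
  row i := PiLp.proj 2 (fun _ : Fin n => H) i ∘L
    (U.symm.toContinuousLinearEquiv : H →L[ℂ] PiLp 2 (fun _ : Fin n => H))
  row_mul_col i j := by
    ext v
    by_cases h : i = j
    · subst h; simp
    · simp [h]
  sum_col_mul_row := by
    ext v
    apply U.symm.injective
    ext i
    simp [Pi.single_apply]

theorem unitaryBlocks_row_apply {n : ℕ} (U : PiLp 2 (fun _ : Fin n => H) ≃ₗᵢ[ℂ] H) (i : Fin n)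
    (v : H) : (unitaryBlocks U).row i v = U.symm v i := rfl

theorem unitaryBlocks_col_apply {n : ℕ} (U : PiLp 2 (fun _ : Fin n => H) ≃ₗᵢ[ℂ] H) (i : Fin n)
    (v : H) : (unitaryBlocks U).col i v = U (WithLp.toLp 2 (Pi.single i v)) := rfl

theorem norm_unitaryBlocks_row_le {n : ℕ} (U : PiLp 2 (fun _ : Fin n => H) ≃ₗᵢ[ℂ] H)
    (i : Fin n) : ‖(unitaryBlocks U).row i‖ ≤ 1 := by
  refine ContinuousLinearMap.opNorm_le_bound _ zero_le_one fun v => ?_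
  rw [unitaryBlocks_row_apply, one_mul, ← U.symm.norm_map v]
  exact PiLp.norm_apply_le _ i

theorem norm_unitaryBlocks_col_le {n : ℕ} (U : PiLp 2 (fun _ : Fin n => H) ≃ₗᵢ[ℂ] H)
    (i : Fin n) : ‖(unitaryBlocks U).col i‖ ≤ 1 := by
  refine ContinuousLinearMap.opNorm_le_bound _ zero_le_one fun v => ?_
  rw [unitaryBlocks_col_apply, one_mul, U.norm_map]
  simp

theorem norm_unitaryBlocks_blocks_le {n : ℕ} (U : PiLp 2 (fun _ : Fin n => H) ≃ₗᵢ[ℂ] H)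
    (a : H →L[ℂ] H) (i j : Fin n) :
    ‖(unitaryBlocks U).blocks (unitaryBlocks U) a i j‖ ≤ ‖a‖ := by
  rw [BlockSystem.blocks_apply]
  calc _ ≤ ‖(unitaryBlocks U).row i‖ * ‖a‖ * ‖(unitaryBlocks U).col j‖ :=
        (norm_mul_le _ _).trans (by gcongr; exact norm_mul_le _ _)
    _ ≤ 1 * ‖a‖ * 1 := by
        gcongr
        exacts [norm_unitaryBlocks_row_le U i, norm_unitaryBlocks_col_le U j]
    _ = ‖a‖ := by ring

theorem unitaryConj_apply {n : ℕ} (U : PiLp 2 (fun _ : Fin n => H) ≃ₗᵢ[ℂ] H)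
    (M : Matrix (Fin n) (Fin n) (H →L[ℂ] H)) (v : H) :
    unitaryConj U M v = U (blockOp M (U.symm v)) := rfl

theorem unitaryConj_eq_assemble {n : ℕ} (U : PiLp 2 (fun _ : Fin n => H) ≃ₗᵢ[ℂ] H)
    (M : Matrix (Fin n) (Fin n) (H →L[ℂ] H)) :
    unitaryConj U M = (unitaryBlocks U).assemble (unitaryBlocks U) M := by
  ext v
  apply U.symm.injective
  ext i
  rw [unitaryConj_apply, LinearIsometryEquiv.symm_apply_apply, blockOp_apply]
  simp [BlockSystem.assemble, unitaryBlocks_row_apply, unitaryBlocks_col_apply, Pi.single_apply]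

theorem norm_unitaryConj_le {n : ℕ} (U : PiLp 2 (fun _ : Fin n => H) ≃ₗᵢ[ℂ] H)
    (M : Matrix (Fin n) (Fin n) (H →L[ℂ] H)) {C : ℝ} (hC : 0 ≤ C)
    (h : ∀ v : PiLp 2 (fun _ : Fin n => H), ‖blockOp M v‖ ≤ C * ‖v‖) :
    ‖unitaryConj U M‖ ≤ C := by
  refine ContinuousLinearMap.opNorm_le_bound _ hC fun v => ?_
  rw [unitaryConj_apply, U.norm_map, ← U.symm.norm_map v]
  exact h _

/-- An operator that commutes with all operators is a scalar. -/
theorem exists_eq_smul_one_of_forall_commute (c : H →L[ℂ] H)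
    (h : ∀ L : H →L[ℂ] H, L * c = c * L) : ∃ a : ℂ, c = a • 1 := by
  by_cases hH : ∃ e : H, e ≠ 0
  · obtain ⟨e, he⟩ := hH
    have he' : ((‖e‖ : ℝ) : ℂ) ^ 2 ≠ 0 := by simpa using he
    refine ⟨inner ℂ e (c e) / (‖e‖ : ℂ) ^ 2, ?_⟩
    ext x
    -- Commutation is tested on the rank-one operator v ↦ ⟨e, v⟩ x, evaluated at e.
    have := congrArg (fun T : H →L[ℂ] H => T e) (h ((innerSL ℂ e).smulRight x))
    have hx : inner ℂ e (c e) • x = ((‖e‖ : ℝ) : ℂ) ^ 2 • c x := by simpa using this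
    change c x = (inner ℂ e (c e) / (‖e‖ : ℂ) ^ 2) • x
    rw [div_eq_inv_mul, mul_smul, hx, smul_smul, inv_mul_cancel₀ he', one_smul]
  · push Not at hH
    exact ⟨0, by ext x; simp [hH]⟩

/-! ### Free polynomials and intertwinings -/

variable {d : ℕ} {A : Subalgebra ℂ (H →L[ℂ] H)} {Ω : Set (Fin d → A)}
  {G : (Fin d → A) → (H →L[ℂ] H)}

/-- The product of the entries of `x` along a word. -/
def wordProd {R : Type*} [Monoid R] (x : Fin d → R) (l : List (Fin d)) : R := (l.map x).prod

theorem evalPoly_wordProd (x : Fin d → A) (l : List (Fin d)) :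
    evalPoly (wordProd (FreeAlgebra.ι ℂ) l) x = wordProd (fun r => (x r : H →L[ℂ] H)) l := by
  simp only [evalPoly, wordProd, map_list_prod, List.map_map]
  rw [← Subalgebra.coe_val, map_list_prod, List.map_map]
  congr 2
  ext r : 1
  simp

theorem isHomogeneousFree_wordProd (l : List (Fin d)) :
    IsHomogeneousFree l.length (wordProd (FreeAlgebra.ι ℂ) l) := by
  refine Submodule.subset_span ⟨l.get, ?_⟩
  simp only [wordProd]
  congr 1
  conv_rhs => rw [← List.ofFn_get l, List.map_ofFn]
  rfl

theorem prod_ofFn_smul {R : Type*} [Ring R] [Algebra ℂ R] (t : ℂ) :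
    ∀ {k : ℕ} (f : Fin k → R),
      (List.ofFn fun i => t • f i).prod = t ^ k • (List.ofFn f).prod
  | 0, f => by simp
  | k + 1, f => by
    rw [List.ofFn_succ, List.ofFn_succ, List.prod_cons, List.prod_cons,
      prod_ofFn_smul t fun i => f i.succ, smul_mul_smul_comm, pow_succ']

theorem evalPoly_smul_of_isHomogeneousFree {k : ℕ} {p : FreeAlgebra ℂ (Fin d)}
    (hp : IsHomogeneousFree k p) (t : ℂ) (x : Fin d → A) :
    evalPoly p (t • x) = t ^ k • evalPoly p x := by
  suffices h : FreeAlgebra.lift ℂ (t • x) p = t ^ k • FreeAlgebra.lift ℂ x p by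
    simp [evalPoly, h]
  induction hp using Submodule.span_induction with
  | mem p h =>
    obtain ⟨w, rfl⟩ := h
    simp only [map_list_prod, List.map_ofFn]
    rw [← prod_ofFn_smul]
    congr 2
    ext i : 1
    simp
  | zero => simp
  | add p q _ _ hp hq => simp [hp, hq]
  | smul a p _ hp => simp [hp, smul_comm a]

theorem continuous_evalPoly (p : FreeAlgebra ℂ (Fin d)) :
    Continuous fun x : Fin d → A => evalPoly p x := by
  suffices h : Continuous fun x : Fin d → A => FreeAlgebra.lift ℂ x p from
    continuous_subtype_val.comp h
  induction p using FreeAlgebra.induction with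
  | grade0 a => simpa using continuous_const
  | grade1 r => simpa using continuous_apply r
  | mul p q hp hq => simp only [map_mul]; exact hp.mul hq
  | add p q hp hq => simp only [map_add]; exact hp.add hq

theorem mul_evalPoly_of_intertwine (p : FreeAlgebra ℂ (Fin d)) (x y : Fin d → A)
    (L : H →L[ℂ] H) (h : ∀ r, L * (x r : H →L[ℂ] H) = y r * L) :
    L * evalPoly p x = evalPoly p y * L := by
  unfold evalPoly
  induction p using FreeAlgebra.induction with
  | grade0 a => simp [Algebra.algebraMap_eq_smul_one]
  | grade1 r => simpa using h r
  | mul p q hp hq =>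
    simp only [map_mul, Subalgebra.coe_mul]
    rw [← mul_assoc, hp, mul_assoc, hq, mul_assoc]
  | add p q hp hq => simp [mul_add, add_mul, hp, hq]

/-- `G` preserves intertwinings between points of `Ω`. -/
def IntertwinesOn (Ω : Set (Fin d → A)) (G : (Fin d → A) → (H →L[ℂ] H)) : Prop :=
  ∀ x ∈ Ω, ∀ y ∈ Ω, ∀ L : H →L[ℂ] H,
    (∀ r, L * (x r : H →L[ℂ] H) = y r * L) → L * G x = G y * L

/-- A rectangular K assembles to a single operator on `H`, so the two points may be cut into
different numbers of blocks. -/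
theorem IntertwinesOn.mul_blocks {ι κ : Type*} [Fintype ι] [DecidableEq ι] [Fintype κ]
    [DecidableEq κ] (hG : IntertwinesOn Ω G) {x y : Fin d → A} (hx : x ∈ Ω) (hy : y ∈ Ω)
    (E : BlockSystem ι (H →L[ℂ] H)) (E' : BlockSystem κ (H →L[ℂ] H))
    (K : Matrix κ ι (H →L[ℂ] H)) (M : Fin d → Matrix ι ι (H →L[ℂ] H))
    (N : Fin d → Matrix κ κ (H →L[ℂ] H))
    (hM : ∀ r, (x r : H →L[ℂ] H) = E.assemble E (M r))
    (hN : ∀ r, (y r : H →L[ℂ] H) = E'.assemble E' (N r))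
    (h : ∀ r, K * M r = N r * K) :
    K * E.blocks E (G x) = E'.blocks E' (G y) * K := by
  have := hG x hx y hy (E'.assemble E K) fun r => by
    rw [hM, hN, BlockSystem.assemble_mul, BlockSystem.assemble_mul, h]
  have := congrArg (E'.blocks E) this
  rwa [E'.blocks_mul E E, E'.blocks_mul E' E, BlockSystem.blocks_assemble] at this

/-- Listing the indices by decreasing `f` makes these matrices strictly upper triangular; the order
dual in `g` reverses the sort. -/
theorem HasDirectSumProperty.exists_blockSystem (hA : HasDirectSumProperty A) {κ : Type*}
    [Fintype κ] [DecidableEq κ] [Nonempty κ] (f : κ → ℕ) :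
    ∃ E : BlockSystem κ (H →L[ℂ] H), ∀ M : Matrix κ κ (H →L[ℂ] H), (∀ i j, M i j ∈ A) →
      (∀ i j, f i ≤ f j → M i j = 0) → E.assemble E M ∈ A := by
  obtain ⟨U, hU⟩ := hA (Fintype.card κ) Fintype.card_pos
  let g : Fin (Fintype.card κ) → ℕᵒᵈ := fun a => OrderDual.toDual (f ((Fintype.equivFin κ).symm a))
  let e : Fin (Fintype.card κ) ≃ κ := (Tuple.sort g).trans (Fintype.equivFin κ).symm
  have he : ∀ a b, a ≤ b → f (e b) ≤ f (e a) := fun a b hab => Tuple.monotone_sort g hab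
  refine ⟨(unitaryBlocks U).reindex e, fun M hM hf => ?_⟩
  rw [BlockSystem.assemble_reindex, ← unitaryConj_eq_assemble]
  exact hU _ (fun i j => hM _ _) fun i j hij => hf _ _ (he _ _ (le_of_lt hij))

/-! ### Creation operators and bidiagonal matrices -/

/-- Words of length at most `k`. -/
abbrev Word (d k : ℕ) : Type := {l : List (Fin d) // l.length ≤ k}

instance (d k : ℕ) : Fintype (Word d k) :=
  (List.finite_length_le (Fin d) k).fintype

/-- The empty word. -/
def Word.empty (d k : ℕ) : Word d k := ⟨[], Nat.zero_le k⟩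

instance (d k : ℕ) : Nonempty (Word d k) := ⟨Word.empty d k⟩

/-- Left multiplication by a letter on words of length at most `k`, scaled by `s`. -/
def creation (R : Type*) [Ring R] [Algebra ℂ R] (k : ℕ) (s : ℂ) (r : Fin d) :
    Matrix (Word d k) (Word d k) R :=
  Matrix.of fun v w => if v.1 = r :: w.1 then s • 1 else 0

section Creation

variable {R : Type*} [Ring R] [Algebra ℂ R]

theorem mul_creation_apply {ι : Type*} {k : ℕ} (s : ℂ) (r : Fin d)
    (K : Matrix ι (Word d k) R) (i : ι) (w : Word d k) :
    (K * creation R k s r) i w =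
      if h : w.1.length < k then s • K i ⟨r :: w.1, h⟩ else 0 := by
  simp only [Matrix.mul_apply, creation, Matrix.of_apply]
  split_ifs with h
  · rw [Finset.sum_eq_single ⟨r :: w.1, h⟩]
    · simp
    · intro v _ hv
      rw [if_neg fun h' => hv (Subtype.ext h'), mul_zero]
    · simp
  · refine Finset.sum_eq_zero fun v _ => ?_
    rw [if_neg, mul_zero]
    intro h'
    have := v.2
    rw [h', List.length_cons] at this
    omega

/-- The bidiagonal matrix with `a` on the superdiagonal, `t a` in the last corner and zeros
elsewhere. -/
def cornerShift (n : ℕ) (t : ℂ) (a : R) : Matrix (Fin (n + 1)) (Fin (n + 1)) R :=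
  Matrix.of fun i j =>
    if i.val + 1 = j.val then a else if i = Fin.last n ∧ j = Fin.last n then t • a else 0

theorem cornerShift_castSucc (n : ℕ) (t : ℂ) (a : R) (i : Fin n) (j : Fin (n + 1)) :
    cornerShift n t a i.castSucc j = if j = i.succ then a else 0 := by
  simp only [cornerShift, Matrix.of_apply, Fin.ext_iff, Fin.val_castSucc, Fin.val_succ,
    Fin.val_last]
  have := i.2
  split_ifs <;> first | rfl | (exfalso; omega)

theorem cornerShift_last (n : ℕ) (t : ℂ) (a : R) (j : Fin (n + 1)) :
    cornerShift n t a (Fin.last n) j = if j = Fin.last n then t • a else 0 := by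
  have := j.2
  have h : n + 1 ≠ j.val := by omega
  simp [cornerShift, h]

theorem cornerShift_mul_castSucc {κ : Type*} (n : ℕ) (t : ℂ) (a : R)
    (K : Matrix (Fin (n + 1)) κ R) (i : Fin n) (w : κ) :
    (cornerShift n t a * K) i.castSucc w = a * K i.succ w := by
  simp [Matrix.mul_apply, cornerShift_castSucc]

theorem cornerShift_mul_last {κ : Type*} (n : ℕ) (t : ℂ) (a : R)
    (K : Matrix (Fin (n + 1)) κ R) (w : κ) :
    (cornerShift n t a * K) (Fin.last n) w = t • a * K (Fin.last n) w := by
  simp [Matrix.mul_apply, cornerShift_last]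

theorem blockTriangular_cornerShift (n : ℕ) (t : ℂ) (a : R) :
    (cornerShift n t a).BlockTriangular id := by
  intro i j hij
  have hij' : j < i := hij
  induction i using Fin.lastCases with
  | last => rw [cornerShift_last, if_neg hij'.ne]
  | cast i =>
    rw [cornerShift_castSucc, if_neg]
    rintro rfl
    simp [Fin.lt_def] at hij'

/-- Row i of `K` sees only words of length k - i, so adding a letter moves up one row. Since k < n
the last row vanishes and the corner plays no role; each s⁻¹ cancels the scaling of one letter. -/
theorem creation_intertwine (n k : ℕ) (hk : k < n) (s t : ℂ) (hs : s ≠ 0) (x : Fin d → R)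
    (r : Fin d) :
    let K : Matrix (Fin (n + 1)) (Word d k) R := Matrix.of fun i w =>
      if w.1.length + i.val = k then s⁻¹ ^ w.1.length • wordProd x w.1 else 0
    K * creation R k s r = cornerShift n t (x r) * K := by
  intro K
  ext i w
  rw [mul_creation_apply]
  induction i using Fin.lastCases with
  | last =>
    rw [cornerShift_mul_last]
    simp only [K, Matrix.of_apply, Fin.val_last, List.length_cons]
    rw [if_neg (by omega), if_neg (by omega)]
    simp
  | cast i =>
    rw [cornerShift_mul_castSucc]
    simp only [K, Matrix.of_apply, Fin.val_castSucc, Fin.val_succ, List.length_cons]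
    by_cases h : w.1.length + 1 + i.val = k
    · rw [dif_pos (by omega), if_pos h, if_pos (by omega)]
      simp only [wordProd, List.map_cons, List.prod_cons, mul_smul_comm, smul_smul]
      congr 1
      rw [pow_succ', ← mul_assoc, mul_inv_cancel₀ hs, one_mul]
    · rw [if_neg h, if_neg (by omega)]
      simp

end Creation

theorem cornerShift_mem (n : ℕ) (t : ℂ) (a : A) (i j : Fin (n + 1)) :
    cornerShift n t (a : H →L[ℂ] H) i j ∈ A := by
  simp only [cornerShift, Matrix.of_apply]
  split_ifs
  exacts [a.2, A.smul_mem a.2 t, A.zero_mem]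

/-- The constant is coarse, but independent of n: one ball around 0 serves all sizes. -/
theorem norm_unitaryConj_cornerShift_le {n : ℕ}
    (U : PiLp 2 (fun _ : Fin (n + 1) => H) ≃ₗᵢ[ℂ] H) {t : ℂ} (ht : ‖t‖ ≤ 1) (a : H →L[ℂ] H) :
    ‖unitaryConj U (cornerShift n t a)‖ ≤ 2 * ‖a‖ := by
  refine norm_unitaryConj_le U _ (by positivity) fun v => ?_
  have hcast : ∀ i : Fin n, blockOp (cornerShift n t a) v i.castSucc = a (v i.succ) := by
    intro i
    rw [blockOp_apply, Finset.sum_eq_single i.succ]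
    · simp [cornerShift_castSucc]
    · intro j _ hj
      simp [cornerShift_castSucc, hj]
    · simp
  have hlast : blockOp (cornerShift n t a) v (Fin.last n) = t • a (v (Fin.last n)) := by
    rw [blockOp_apply, Finset.sum_eq_single (Fin.last n)]
    · simp [cornerShift_last]
    · intro j _ hj
      simp [cornerShift_last, hj]
    · simp
  refine le_of_sq_le_sq ?_ (by positivity)
  have h1 : ∑ i : Fin n, ‖v i.succ‖ ^ 2 ≤ ‖v‖ ^ 2 := by
    rw [PiLp.norm_sq_eq_of_L2, Fin.sum_univ_succ]
    exact le_add_of_nonneg_left (by positivity)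
  have h2 : ‖v (Fin.last n)‖ ≤ ‖v‖ := PiLp.norm_apply_le v _
  have h3 : ∀ w : H, ‖a w‖ ^ 2 ≤ ‖a‖ ^ 2 * ‖w‖ ^ 2 := fun w => by
    rw [← mul_pow]
    exact pow_le_pow_left₀ (norm_nonneg _) (a.le_opNorm w) 2
  have h4 : ‖t • a (v (Fin.last n))‖ ^ 2 ≤ ‖a‖ ^ 2 * ‖v‖ ^ 2 := by
    rw [norm_smul]
    calc (‖t‖ * ‖a (v (Fin.last n))‖) ^ 2 ≤ (1 * ‖a (v (Fin.last n))‖) ^ 2 := by gcongr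
      _ ≤ ‖a‖ ^ 2 * ‖v (Fin.last n)‖ ^ 2 := by rw [one_mul]; exact h3 _
      _ ≤ _ := by gcongr
  rw [PiLp.norm_sq_eq_of_L2, Fin.sum_univ_castSucc]
  simp only [hcast, hlast]
  calc ∑ i : Fin n, ‖a (v i.succ)‖ ^ 2 + ‖t • a (v (Fin.last n))‖ ^ 2
      ≤ ∑ i : Fin n, ‖a‖ ^ 2 * ‖v i.succ‖ ^ 2 + ‖a‖ ^ 2 * ‖v‖ ^ 2 := by
        gcongr
        exact h3 _
    _ ≤ ‖a‖ ^ 2 * ‖v‖ ^ 2 + ‖a‖ ^ 2 * ‖v‖ ^ 2 := by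
        rw [← Finset.mul_sum]
        gcongr
    _ ≤ (2 * ‖a‖ * ‖v‖) ^ 2 := by nlinarith [mul_nonneg (sq_nonneg ‖a‖) (sq_nonneg ‖v‖)]

/-! ### Homogeneous components and the expansion near zero -/

/-- The `k`-th homogeneous component of `G`, read off from the values of `G` at bidiagonal
matrices. -/
theorem exists_homogeneous_component (hA : HasDirectSumProperty A) (hΩ : Ω ∈ 𝓝 0)
    (hG : IntertwinesOn Ω G) (k : ℕ) :
    ∃ p : FreeAlgebra ℂ (Fin d), IsHomogeneousFree k p ∧
      ∀ n, ∀ hk : k < n, ∀ (U : PiLp 2 (fun _ : Fin (n + 1) => H) ≃ₗᵢ[ℂ] H) (t : ℂ)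
        (x z : Fin d → A), z ∈ Ω →
        (∀ r, (z r : H →L[ℂ] H) = unitaryConj U (cornerShift n t (x r : H →L[ℂ] H))) →
        (unitaryBlocks U).blocks (unitaryBlocks U) (G z) 0 ⟨k, by omega⟩ = evalPoly p x := by
  obtain ⟨E, hE⟩ := hA.exists_blockSystem (κ := Word d k) (fun w => w.1.length)
  have hT : ∀ (s : ℂ) r, E.assemble E (creation (H →L[ℂ] H) k s r) ∈ A := by
    refine fun s r => hE _ (fun v w => ?_) fun v w hvw => ?_
    · simp only [creation, Matrix.of_apply]
      split_ifs
      exacts [A.smul_mem A.one_mem s, A.zero_mem]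
    · simp only [creation, Matrix.of_apply]
      rw [if_neg]
      intro h
      rw [h, List.length_cons] at hvw
      omega
  let Y : Fin d → A := fun r => ⟨_, hT 1 r⟩
  obtain ⟨s, hsΩ, hs⟩ : ∃ s : ℂ, s • Y ∈ Ω ∧ s ≠ 0 := by
    have h1 : Tendsto (fun s : ℂ => s • Y) (𝓝[≠] 0) (𝓝 0) := by
      have : Continuous fun s : ℂ => s • Y := by fun_prop
      simpa using (this.tendsto 0).mono_left nhdsWithin_le_nhds
    exact ((h1.eventually hΩ).and self_mem_nhdsWithin).exists
  have hY : ∀ r, ((s • Y) r : H →L[ℂ] H) = E.assemble E (creation (H →L[ℂ] H) k s r) := by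
    intro r
    have : creation (H →L[ℂ] H) k s r = s • creation (H →L[ℂ] H) k 1 r := by
      ext1 v w
      simp only [creation, Matrix.of_apply, Matrix.smul_apply]
      split_ifs <;> simp
    rw [this]
    simp [Y, BlockSystem.assemble, Finset.smul_sum]
  let B := E.blocks E (G (s • Y))
  -- Creation matrices have scalar entries, so they commute with the constant diagonal of any `L`,
  -- in `A` or not.
  have hscalar : ∀ v w, ∃ c : ℂ, B v w = c • 1 := by
    intro v w
    refine exists_eq_smul_one_of_forall_commute _ fun L => ?_
    have := hG.mul_blocks hsΩ hsΩ E E (Matrix.diagonal fun _ => L) _ _ hY hY fun r => by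
      ext1 v w
      simp only [Matrix.diagonal_mul, Matrix.mul_diagonal, creation, Matrix.of_apply]
      split_ifs <;> simp
    simpa [B] using congrFun (congrFun this v) w
  choose c hc using hscalar
  refine ⟨∑ w : Word d k, if w.1.length = k then
    (s⁻¹ ^ w.1.length * c w (Word.empty d k)) • wordProd (FreeAlgebra.ι ℂ) w.1 else 0,
    Submodule.sum_mem _ fun w _ => ?_, ?_⟩
  · split_ifs with h
    · refine Submodule.smul_mem _ _ ?_
      have := isHomogeneousFree_wordProd w.1
      rwa [h] at this
    · exact Submodule.zero_mem _
  · intro n hk U t x z hz hzU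
    -- In entry (0, empty word), row 0 of the intertwiner keeps the words of length k, and its
    -- empty-word column is 1 in row k and 0 elsewhere.
    have key := hG.mul_blocks hsΩ hz E (unitaryBlocks U) _ _ _ hY
      (fun r => (hzU r).trans (unitaryConj_eq_assemble U _))
      (creation_intertwine n k hk s t hs fun r => (x r : H →L[ℂ] H))
    have key' := congrFun (congrFun key 0) (Word.empty d k)
    simp only [Matrix.mul_apply, Matrix.of_apply] at key'
    have hev : evalPoly (∑ w : Word d k, if w.1.length = k then
        (s⁻¹ ^ w.1.length * c w (Word.empty d k)) • wordProd (FreeAlgebra.ι ℂ) w.1 else 0) x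
        = ∑ w : Word d k, if w.1.length = k then
        (s⁻¹ ^ w.1.length * c w (Word.empty d k)) • wordProd (fun r => (x r : H →L[ℂ] H)) w.1
        else 0 := by
      unfold evalPoly
      rw [map_sum, AddSubmonoidClass.coe_finsetSum]
      refine Finset.sum_congr rfl fun w _ => ?_
      split_ifs
      · rw [map_smul, ← evalPoly_wordProd]; rfl
      · simp
    rw [hev]
    symm
    convert key' using 1
    · refine Finset.sum_congr rfl fun w _ => ?_
      simp only [Fin.val_zero, add_zero]
      split_ifs
      · change _ = _ * B w _
        rw [hc, smul_mul_smul_comm, mul_one]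
      · rw [zero_mul]
    · rw [Finset.sum_eq_single ⟨k, by omega⟩]
      · simp [Word.empty, wordProd]
      · intro j _ hj
        rw [if_neg, mul_zero]
        intro h
        apply hj
        ext
        simpa [Word.empty] using h
      · simp

theorem eventually_nhds_zero_iff {P : (Fin d → A) → Prop} :
    (∀ᶠ y in 𝓝 0, P y) ↔
      ∃ ρ > 0, ∀ y : Fin d → A, (∀ r, ‖(y r : H →L[ℂ] H)‖ < ρ) → P y := by
  rw [Metric.eventually_nhds_iff]
  refine exists_congr fun ρ => and_congr_right fun hρ => forall_congr' fun y => ?_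
  rw [dist_pi_lt_iff hρ]
  have : ∀ r, dist (y r) ((0 : Fin d → A) r) = ‖(y r : H →L[ℂ] H)‖ := fun r =>
    dist_zero_right (y r : H →L[ℂ] H)
  simp only [this]

theorem exists_hasSum_evalPoly_near_zero (hA : HasDirectSumProperty A) (hΩ : Ω ∈ 𝓝 0)
    (hG : IntertwinesOn Ω G) (hb : ∃ C, ∀ᶠ y in 𝓝 0, ‖G y‖ ≤ C) :
    ∃ p : ℕ → FreeAlgebra ℂ (Fin d), (∀ k, IsHomogeneousFree k (p k)) ∧
      ∀ᶠ x in 𝓝 (0 : Fin d → A), HasSum (fun k => evalPoly (p k) x) (G x) := by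
  choose p hp hpG using exists_homogeneous_component hA hΩ hG
  refine ⟨p, hp, ?_⟩
  obtain ⟨C, hC⟩ := hb
  obtain ⟨ρ, hρ, hball⟩ := eventually_nhds_zero_iff.mp (hC.and hΩ)
  -- The bound ρ / 2 absorbs the factor 2 in the norm of the bidiagonal matrix. Replacing x by 2 x
  -- then removes the powers of t = 1/2.
  suffices h : ∀ x : Fin d → A, (∀ r, ‖(x r : H →L[ℂ] H)‖ < ρ / 2) →
      HasSum (fun k => (1 / 2 : ℂ) ^ k • evalPoly (p k) x) (G ((1 / 2 : ℂ) • x)) by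
    refine eventually_nhds_zero_iff.mpr ⟨ρ / 4, by positivity, fun x hx => ?_⟩
    have := h ((2 : ℂ) • x) fun r => by
      have := hx r
      rw [Pi.smul_apply, Subalgebra.coe_smul, norm_smul, Complex.norm_ofNat]
      linarith
    simpa [evalPoly_smul_of_isHomogeneousFree (hp _), smul_smul, ← mul_pow] using this
  intro x hx
  have hmain : ∀ n, ∃ g : Fin (n + 1) → (H →L[ℂ] H), (∀ i, ‖g i‖ ≤ C) ∧
      (∀ k (hk : k < n), g ⟨k, by omega⟩ = evalPoly (p k) x) ∧
      G ((1 / 2 : ℂ) • x) = ∑ i, (1 / 2 : ℂ) ^ i.val • g i := by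
    intro n
    obtain ⟨U, hU⟩ := hA (n + 1) (by omega)
    let z : Fin d → A := fun r => ⟨unitaryConj U (cornerShift n (1 / 2) (x r : H →L[ℂ] H)),
      hU _ (cornerShift_mem n _ (x r)) (blockTriangular_cornerShift _ _ _)⟩
    have hz := hball z fun r =>
      (norm_unitaryConj_cornerShift_le U (by norm_num) _).trans_lt (by linarith [hx r])
    have hx2 := hball ((1 / 2 : ℂ) • x) fun r => by
      have := hx r
      have := norm_nonneg (x r : H →L[ℂ] H)
      rw [Pi.smul_apply, Subalgebra.coe_smul, norm_smul]
      norm_num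
      linarith
    refine ⟨fun i => (unitaryBlocks U).blocks (unitaryBlocks U) (G z) 0 i,
      fun i => (norm_unitaryBlocks_blocks_le U _ _ _).trans hz.1,
      fun k hk => hpG k n hk U (1 / 2) x z hz.2 fun r => rfl, ?_⟩
    have key := hG.mul_blocks hx2.2 hz.2 (BlockSystem.trivial _) (unitaryBlocks U)
      (Matrix.of fun (i : Fin (n + 1)) (_ : Unit) => (1 / 2 : ℂ) ^ i.val • (1 : H →L[ℂ] H))
      (fun r => Matrix.of fun _ _ => (((1 / 2 : ℂ) • x) r : H →L[ℂ] H)) _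
      (fun r => by rw [BlockSystem.assemble_trivial]; rfl)
      (fun r => unitaryConj_eq_assemble U _) (fun r => by
        ext1 i j
        induction i using Fin.lastCases with
        | last =>
          rw [cornerShift_mul_last]
          simp [Matrix.mul_apply, smul_smul, mul_comm]
        | cast i =>
          rw [cornerShift_mul_castSucc]
          simp [Matrix.mul_apply, smul_smul, pow_succ])
    have := congrFun (congrFun key 0) ()
    simpa [Matrix.mul_apply, BlockSystem.blocks_trivial] using this
  have hbound : ∀ k, ‖evalPoly (p k) x‖ ≤ C := fun k => by
    obtain ⟨g, hg, hgp, -⟩ := hmain (k + 1)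
    rw [← hgp k (by omega)]
    exact hg _
  have hsum : Summable fun k => ‖(1 / 2 : ℂ) ^ k • evalPoly (p k) x‖ := by
    refine Summable.of_nonneg_of_le (fun _ => norm_nonneg _) (fun k => ?_)
      (summable_geometric_two.mul_right C)
    rw [norm_smul, norm_pow]
    gcongr
    · norm_num
    · exact hbound k
  refine (hasSum_iff_tendsto_nat_of_summable_norm hsum).mpr ?_
  rw [tendsto_iff_norm_sub_tendsto_zero]
  -- Only the last of the n + 1 terms is not known to be polynomial, and its weight is 2⁻ⁿ.
  refine squeeze_zero (fun _ => norm_nonneg _) (g := fun n => (1 / 2 : ℝ) ^ n * C) (fun n => ?_) ?_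
  · obtain ⟨g, hg, hgp, hgs⟩ := hmain n
    rw [hgs, Fin.sum_univ_castSucc, ← Fin.sum_univ_eq_sum_range
      (fun k => (1 / 2 : ℂ) ^ k • evalPoly (p k) x)]
    have : ∑ i : Fin n, (1 / 2 : ℂ) ^ i.castSucc.val • g i.castSucc
        = ∑ i : Fin n, (1 / 2 : ℂ) ^ i.val • evalPoly (p i) x :=
      Finset.sum_congr rfl fun i _ => by rw [← hgp i i.2]; rfl
    rw [this, sub_add_cancel_left, norm_neg, norm_smul, norm_pow]
    gcongr
    · simp
    · exact hg _
  · simpa using (tendsto_pow_atTop_nhds_zero_of_lt_one (r := (1 / 2 : ℝ))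
      (by norm_num) (by norm_num)).mul_const C

/-! ### Taylor expansion in one variable -/

/-- A function holomorphic on a disc of radius `R > 1` is the sum at `1` of its Taylor series at
`0`, and the coefficients satisfy Cauchy's estimates. -/
theorem hasSum_one_and_norm_le_of_hasSum_near_zero {E : Type*} [NormedAddCommGroup E]
    [NormedSpace ℂ E] [CompleteSpace E] {f : ℂ → E} {a : ℕ → E} {R : NNReal} (hR : 1 < R)
    (hf : DifferentiableOn ℂ f (Metric.closedBall 0 R)) {C : ℝ}
    (hC : ∀ t : ℂ, ‖t‖ ≤ R → ‖f t‖ ≤ C)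
    (ha : ∀ᶠ t in 𝓝 (0 : ℂ), HasSum (fun k => t ^ k • a k) (f t)) :
    HasSum a (f 1) ∧ ∀ k, ‖a k‖ ≤ C * (R⁻¹ : ℝ) ^ k := by
  have hR0 : 0 < R := zero_lt_one.trans hR
  have h1 := hf.hasFPowerSeriesOnBall hR0
  let q : FormalMultilinearSeries ℂ ℂ E := fun k =>
    ContinuousMultilinearMap.mkPiRing ℂ (Fin k) (a k)
  have hq : ∀ k, q.coeff k = a k := fun k => by simp [q, FormalMultilinearSeries.coeff]
  have h2 : HasFPowerSeriesAt f q 0 := hasFPowerSeriesAt_iff.mpr (by simpa [hq] using ha)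
  have h3 : cauchyPowerSeries f 0 R = q := h1.hasFPowerSeriesAt.eq_formalMultilinearSeries h2
  rw [h3] at h1
  refine ⟨?_, fun k => ?_⟩
  · have := h1.hasSum (y := 1) (by simpa [Metric.mem_eball, edist_zero_right] using hR)
    simpa [q] using this
  · have h4 := norm_cauchyPowerSeries_le f 0 R k
    have h5 : ‖q k‖ = ‖a k‖ := ContinuousMultilinearMap.norm_mkPiRing _
    rw [h3, h5] at h4
    refine h4.trans ?_
    have h6 : ∫ θ in (0 : ℝ)..2 * Real.pi, ‖f (circleMap 0 R θ)‖ ≤ C * (2 * Real.pi) := by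
      have := intervalIntegral.norm_integral_le_of_norm_le_const (a := 0) (b := 2 * Real.pi)
        (f := fun θ => ‖f (circleMap 0 R θ)‖) (C := C) fun θ _ => by
          rw [norm_norm]
          exact hC _ (by simp)
      rw [sub_zero, abs_of_pos Real.two_pi_pos] at this
      exact (Real.le_norm_self _).trans this
    rw [NNReal.abs_eq]
    gcongr
    rwa [inv_mul_le_iff₀ Real.two_pi_pos, mul_comm _ C]

/-! ### Continuity and differentiability from triangular points -/

/-- The point of `A ^ d` with the upper triangular `2 × 2` block form `[a, b; 0, c]`. -/
def upperTriangular {U : PiLp 2 (fun _ : Fin 2 => H) ≃ₗᵢ[ℂ] H} (hU : MapsTriangular A U)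
    (a b c : Fin d → A) : Fin d → A := fun r =>
  ⟨unitaryConj U !![(a r : H →L[ℂ] H), b r; 0, c r], hU _
    (fun i j => by fin_cases i <;> fin_cases j <;> simp) fun i j hij => by
      fin_cases i <;> fin_cases j <;> simp_all⟩

section UpperTriangular

variable {U : PiLp 2 (fun _ : Fin 2 => H) ≃ₗᵢ[ℂ] H} (hU : MapsTriangular A U)

theorem continuous_upperTriangular {X : Type*} [TopologicalSpace X] {a b c : X → Fin d → A}
    (ha : Continuous a) (hb : Continuous b) (hc : Continuous c) :
    Continuous fun t => upperTriangular hU (a t) (b t) (c t) := by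
  refine continuous_pi fun r => Continuous.subtype_mk ?_ _
  simp only [unitaryConj_eq_assemble, BlockSystem.assemble, Fin.sum_univ_two, Matrix.of_apply,
    Matrix.cons_val_zero, Matrix.cons_val_one]
  have h : ∀ {f : X → Fin d → A}, Continuous f → Continuous fun t => (f t r : H →L[ℂ] H) :=
    fun hf => continuous_subtype_val.comp ((continuous_apply r).comp hf)
  have := h ha
  have := h hb
  have := h hc
  fun_prop

/-- The columns (1, 0) and (τ, 1) intertwine a and c, respectively, with the triangular point. -/
theorem IntertwinesOn.blocks_upperTriangular (hG : IntertwinesOn Ω G) {a c : Fin d → A}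
    (ha : a ∈ Ω) (hc : c ∈ Ω) (τ : ℂ) (hz : upperTriangular hU a (τ • (c - a)) c ∈ Ω) :
    (unitaryBlocks U).blocks (unitaryBlocks U) (G (upperTriangular hU a (τ • (c - a)) c)) 0 1
      = τ • (G c - G a) := by
  set z := upperTriangular hU a (τ • (c - a)) c
  have h : ∀ (y : Fin d → A), y ∈ Ω → ∀ K : Matrix (Fin 2) Unit (H →L[ℂ] H),
      (∀ r, K * (Matrix.of fun _ _ => (y r : H →L[ℂ] H) : Matrix Unit Unit (H →L[ℂ] H))
        = !![(a r : H →L[ℂ] H), ((τ • (c - a)) r : A); 0, c r] * K) →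
      K 0 () * G y = (unitaryBlocks U).blocks (unitaryBlocks U) (G z) 0 0 * K 0 ()
        + (unitaryBlocks U).blocks (unitaryBlocks U) (G z) 0 1 * K 1 () := by
    intro y hy K hK
    have key := hG.mul_blocks hy hz (BlockSystem.trivial _) (unitaryBlocks U) K
      (fun r => Matrix.of fun _ _ => (y r : H →L[ℂ] H)) _
      (fun r => by rw [BlockSystem.assemble_trivial]; rfl)
      (fun r => unitaryConj_eq_assemble U _) hK
    have := congrFun (congrFun key 0) ()
    simpa [Matrix.mul_apply, BlockSystem.blocks_trivial, Fin.sum_univ_two] using this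
  have h1 := h a ha (Matrix.of fun i _ => ![1, 0] i) fun r => by
    ext1 i j
    rw [Matrix.mul_apply, Matrix.mul_apply]
    fin_cases i <;> simp [Fin.sum_univ_two]
  have h2 := h c hc (Matrix.of fun i _ => ![τ • 1, 1] i) fun r => by
    ext1 i j
    rw [Matrix.mul_apply, Matrix.mul_apply]
    fin_cases i <;> simp [Fin.sum_univ_two, smul_sub]
  simp only [Matrix.of_apply, Matrix.cons_val_zero, Matrix.cons_val_one, one_mul, mul_one,
    mul_zero, add_zero, smul_one_mul, mul_smul_comm] at h1 h2
  rw [smul_sub, h2, ← h1, add_sub_cancel_left]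

theorem continuousAt_of_intertwinesOn (hG : IntertwinesOn Ω G) (hΩ : IsOpen Ω)
    (hb : ∀ x ∈ Ω, ∃ C, ∀ᶠ y in 𝓝 x, ‖G y‖ ≤ C)
    (hdiag : ∀ x ∈ Ω, upperTriangular hU x 0 x ∈ Ω) {x : Fin d → A} (hx : x ∈ Ω) :
    ContinuousAt G x := by
  obtain ⟨C, hC⟩ := hb _ (hdiag x hx)
  rw [Metric.continuousAt_iff']
  intro ε hε
  -- As y → x the triangular point tends to x ⊕ x, where `G` is bounded by C; hence τ‖G y - G x‖ ≤ C
  -- < τ ε.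
  let τ : ℝ := (|C| + 1) / ε
  have hτ : 0 < τ := by positivity
  have hcont : Tendsto (fun y => upperTriangular hU x ((τ : ℂ) • (y - x)) y) (𝓝 x)
      (𝓝 (upperTriangular hU x 0 x)) := by
    have : Continuous fun y => upperTriangular hU x ((τ : ℂ) • (y - x)) y :=
      continuous_upperTriangular hU continuous_const (by fun_prop) continuous_id
    simpa using this.tendsto x
  filter_upwards [hcont.eventually hC, hcont.eventually (hΩ.mem_nhds (hdiag x hx)),
    hΩ.mem_nhds hx] with y hyC hyz hy
  have h1 := norm_unitaryBlocks_blocks_le U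
    (G (upperTriangular hU x ((τ : ℂ) • (y - x)) y)) 0 1
  rw [hG.blocks_upperTriangular hU hx hy _ hyz, norm_smul, Complex.norm_real,
    Real.norm_of_nonneg hτ.le] at h1
  rw [dist_eq_norm]
  have h2 : τ * ‖G y - G x‖ < τ * ε := by
    calc τ * ‖G y - G x‖ ≤ C := h1.trans hyC
      _ < |C| + 1 := (le_abs_self C).trans_lt (lt_add_one _)
      _ = τ * ε := by simp only [τ]; field_simp
  exact lt_of_mul_lt_mul_left h2 hτ.le

/-- With the corner fixed at ε x = (ε / (t - t₀)) (t x - t₀ x), the corner of the value is ε times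
the difference quotient; it converges because `G` is continuous at the limiting triangular point. -/
theorem differentiableAt_smul_of_intertwinesOn (hG : IntertwinesOn Ω G) (hΩ : IsOpen Ω)
    (hb : ∀ x ∈ Ω, ∃ C, ∀ᶠ y in 𝓝 x, ‖G y‖ ≤ C)
    (hdiag : ∀ x ∈ Ω, upperTriangular hU x 0 x ∈ Ω) {x : Fin d → A} {t₀ : ℂ}
    (hx : t₀ • x ∈ Ω) : DifferentiableAt ℂ (fun t : ℂ => G (t • x)) t₀ := by
  obtain ⟨ε, hεΩ, hε⟩ : ∃ ε : ℂ, upperTriangular hU (t₀ • x) (ε • x) (t₀ • x) ∈ Ω ∧ ε ≠ 0 := by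
    have h1 : Tendsto (fun ε : ℂ => upperTriangular hU (t₀ • x) (ε • x) (t₀ • x)) (𝓝[≠] 0)
        (𝓝 (upperTriangular hU (t₀ • x) 0 (t₀ • x))) := by
      have : Continuous fun ε : ℂ => upperTriangular hU (t₀ • x) (ε • x) (t₀ • x) :=
        continuous_upperTriangular hU continuous_const (by fun_prop) continuous_const
      simpa using (this.tendsto 0).mono_left nhdsWithin_le_nhds
    exact ((h1.eventually (hΩ.mem_nhds (hdiag _ hx))).and self_mem_nhdsWithin).exists
  have hz : Tendsto (fun t : ℂ => upperTriangular hU (t₀ • x) (ε • x) (t • x)) (𝓝[≠] t₀)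
      (𝓝 (upperTriangular hU (t₀ • x) (ε • x) (t₀ • x))) := by
    have : Continuous fun t : ℂ => upperTriangular hU (t₀ • x) (ε • x) (t • x) :=
      continuous_upperTriangular hU continuous_const continuous_const (by fun_prop)
    exact (this.tendsto t₀).mono_left nhdsWithin_le_nhds
  have hGz := (continuousAt_of_intertwinesOn hU hG hΩ hb hdiag hεΩ).tendsto.comp hz
  have hlim := (((hGz.const_mul ((unitaryBlocks U).row 0)).mul_const
    ((unitaryBlocks U).col 1)).const_smul ε⁻¹)
  refine (hasDerivAt_iff_tendsto_slope.mpr (hlim.congr' ?_)).differentiableAt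
  have htx : ∀ᶠ t : ℂ in 𝓝[≠] t₀, t • x ∈ Ω := by
    have : Continuous fun t : ℂ => t • x := by fun_prop
    exact ((this.tendsto t₀).mono_left nhdsWithin_le_nhds).eventually (hΩ.mem_nhds hx)
  filter_upwards [htx, hz.eventually (hΩ.mem_nhds hεΩ), self_mem_nhdsWithin] with t ht htz hne
  have hne' : t - t₀ ≠ 0 := sub_ne_zero.mpr hne
  have hεx : ε • x = (ε * (t - t₀)⁻¹) • (t • x - t₀ • x) := by
    rw [show t • x - t₀ • x = (t - t₀) • x from (sub_smul t t₀ x).symm, smul_smul, mul_assoc, inv_mul_cancel₀ hne', mul_one]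
  have h1 := hG.blocks_upperTriangular hU hx ht (ε * (t - t₀)⁻¹) (by rwa [← hεx])
  rw [← hεx, BlockSystem.blocks_apply] at h1
  rw [Function.comp_apply, h1, smul_smul, ← mul_assoc, inv_mul_cancel₀ hε, one_mul, slope_def_module]

end UpperTriangular

/-! ### Expansion on the whole domain -/

theorem IsNCDomain.exists_upperTriangular_mem (hΩ : IsNCDomain A Ω) :
    ∃ (U : PiLp 2 (fun _ : Fin 2 => H) ≃ₗᵢ[ℂ] H) (hU : MapsTriangular A U),
      ∀ x ∈ Ω, upperTriangular hU x 0 x ∈ Ω := by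
  obtain ⟨U, hU, h⟩ := hΩ.directSum 2 le_rfl
  refine ⟨U, hU, fun x hx => ?_⟩
  obtain ⟨y, hy, hyx⟩ := h (fun _ => x) fun _ => hx
  convert hy using 1
  ext1 r
  apply Subtype.ext
  rw [hyx]
  change unitaryConj U _ = _
  congr 1
  ext1 i j
  fin_cases i <;> fin_cases j <;> simp

theorem exists_homogeneous_expansion [CompleteSpace H] (hA : HasDirectSumProperty A)
    (hΩ : IsNCDomain A Ω) (hbal : Balanced ℂ Ω) (hne : Ω.Nonempty) (hG : IntertwinesOn Ω G)
    (hb : ∀ x ∈ Ω, ∃ C, ∀ᶠ y in 𝓝 x, ‖G y‖ ≤ C) :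
    ∃ p : ℕ → FreeAlgebra ℂ (Fin d), (∀ k, IsHomogeneousFree k (p k)) ∧
      ∀ x ∈ Ω, ∃ u : ℕ → ℝ, Summable u ∧ ∀ᶠ y in 𝓝 x,
        (∀ k, ‖evalPoly (p k) y‖ ≤ u k) ∧ HasSum (fun k => evalPoly (p k) y) (G y) := by
  have h0 : (0 : Fin d → A) ∈ Ω := by
    obtain ⟨x, hx⟩ := hne
    simpa using hbal.smul_mem (a := (0 : ℂ)) (by simp) hx
  obtain ⟨U, hU, hdiag⟩ := hΩ.exists_upperTriangular_mem
  have hopen := hΩ.isOpen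
  obtain ⟨p, hp, hp0⟩ := exists_hasSum_evalPoly_near_zero hA (hopen.mem_nhds h0) hG (hb 0 h0)
  refine ⟨p, hp, fun x hx => ?_⟩
  obtain ⟨R, hRx, hR⟩ : ∃ R : NNReal, ((R : ℝ) : ℂ) • x ∈ Ω ∧ 1 < R := by
    have h1 : Tendsto (fun R : NNReal => ((R : ℝ) : ℂ) • x) (𝓝[>] 1) (𝓝 x) := by
      have : Continuous fun R : NNReal => ((R : ℝ) : ℂ) • x := by fun_prop
      simpa using (this.tendsto 1).mono_left nhdsWithin_le_nhds
    exact ((h1.eventually (hopen.mem_nhds hx)).and self_mem_nhdsWithin).exists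
  have hR0 : ((R : ℝ) : ℂ) ≠ 0 := by
    exact_mod_cast (zero_lt_one.trans hR).ne'
  have hmem : ∀ y : Fin d → A, ((R : ℝ) : ℂ) • y ∈ Ω → ∀ t : ℂ, ‖t‖ ≤ R → t • y ∈ Ω := by
    intro y hy t ht
    have : t • y = (t / R) • ((R : ℝ) : ℂ) • y := by
      rw [smul_smul, div_mul_cancel₀ _ hR0]
    rw [this]
    refine hbal.smul_mem ?_ hy
    rw [norm_div]
    exact div_le_one_of_le₀ (by simpa using ht) (norm_nonneg _)
  have hcont : ∀ y ∈ Ω, ContinuousAt G y := fun y hy =>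
    continuousAt_of_intertwinesOn hU hG hopen hb hdiag hy
  have hK := isCompact_closedBall (0 : ℂ) R
  obtain ⟨C, hC⟩ := hK.exists_bound_of_continuousOn (f := fun t : ℂ => G (t • x)) fun t ht =>
    ((hcont _ (hmem x hRx t (by simpa using ht))).comp (f := fun t : ℂ => t • x)
      (by fun_prop)).continuousWithinAt
  -- Compactness of the disc carries the bound on t x over to t y for all y near x, so the Cauchy
  -- estimates share one geometric majorant.
  have hev : ∀ᶠ y in 𝓝 x, ∀ t ∈ Metric.closedBall (0 : ℂ) R, ‖G (t • y)‖ < C + 1 := by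
    refine hK.eventually_forall_of_forall_eventually fun t ht => ?_
    have h1 : ContinuousAt (fun q : (Fin d → A) × ℂ => G (q.2 • q.1)) (x, t) :=
      ContinuousAt.comp (f := fun q : (Fin d → A) × ℂ => q.2 • q.1)
        (hcont _ (hmem x hRx t (by simpa using ht))) (by fun_prop)
    exact h1.norm.eventually_lt_const ((hC t ht).trans_lt (lt_add_one C))
  have hev' : ∀ᶠ y in 𝓝 x, ((R : ℝ) : ℂ) • y ∈ Ω := by
    have : Continuous fun y : Fin d → A => ((R : ℝ) : ℂ) • y := by fun_prop
    exact (this.tendsto x).eventually (hopen.mem_nhds hRx)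
  refine ⟨fun k => (C + 1) * (R⁻¹ : ℝ) ^ k, (summable_geometric_of_lt_one
    (inv_nonneg.mpr R.coe_nonneg) (inv_lt_one_of_one_lt₀ hR)).mul_left _, ?_⟩
  filter_upwards [hev, hev'] with y hy hyR
  have h := hasSum_one_and_norm_le_of_hasSum_near_zero (f := fun t : ℂ => G (t • y))
    (a := fun k => evalPoly (p k) y) hR
    (fun t ht => (differentiableAt_smul_of_intertwinesOn hU hG hopen hb hdiag
      (hmem y hyR t (by simpa using ht))).differentiableWithinAt)
    (fun t ht => (hy t (by simpa using ht)).le) (by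
      have : Tendsto (fun t : ℂ => t • y) (𝓝 0) (𝓝 0) := by
        have : Continuous fun t : ℂ => t • y := by fun_prop
        simpa using this.tendsto 0
      filter_upwards [this.eventually hp0] with t ht
      simpa only [evalPoly_smul_of_isHomogeneousFree (hp _)] using ht)
  exact ⟨h.2, by simpa using h.1⟩

/-- A local uniform limit of free polynomials is locally bounded. -/
theorem exists_norm_le_of_tendstoUniformlyOn {F : Ω → (H →L[ℂ] H)}
    {q : ℕ → FreeAlgebra ℂ (Fin d)} {x : Ω} {V : Set Ω} (hV : V ∈ 𝓝 x)
    (h : TendstoUniformlyOn (fun (n : ℕ) (y : Ω) => evalPoly (q n) y.1) F atTop V) :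
    ∃ W ∈ 𝓝 x, ∃ C : ℝ, ∀ y ∈ W, ‖F y‖ ≤ C := by
  obtain ⟨n, hn⟩ := (Metric.tendstoUniformlyOn_iff.mp h 1 one_pos).exists
  have hc : Continuous fun y : Ω => ‖evalPoly (q n) y.1‖ :=
    ((continuous_evalPoly (q n)).comp continuous_subtype_val).norm
  refine ⟨V ∩ {y | ‖evalPoly (q n) y.1‖ < ‖evalPoly (q n) x.1‖ + 1}, inter_mem hV
    (hc.continuousAt.eventually_lt_const (lt_add_one _)), ‖evalPoly (q n) x.1‖ + 2, ?_⟩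
  rintro y ⟨hyV, hy⟩
  have h1 := hn y hyV
  rw [dist_eq_norm] at h1
  have h2 := norm_le_norm_add_norm_sub' (F y) (evalPoly (q n) y.1)
  have h3 : ‖evalPoly (q n) y.1‖ < ‖evalPoly (q n) x.1‖ + 1 := hy
  linarith

end NCFun

end

theorem mainTheorem2 {H : Type*} [NormedAddCommGroup H] [InnerProductSpace ℂ H] [CompleteSpace H]
    (hH : ¬ FiniteDimensional ℂ H)
    (A : Subalgebra ℂ (H →L[ℂ] H)) (hAclosed : IsClosed (A : Set (H →L[ℂ] H)))
    (hA : NCFun.HasDirectSumProperty A)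
    (d : ℕ) (hd : 0 < d)
    (Ω : Set (Fin d → A)) (hΩ : NCFun.IsNCDomain A Ω) (hbal : Balanced ℂ Ω)
    (F : Ω → (H →L[ℂ] H)) :
    List.TFAE [
      NCFun.IsNCFunction Ω F,
      ∃ p : ℕ → FreeAlgebra ℂ (Fin d),
        (∀ k, NCFun.IsHomogeneousFree k (p k)) ∧
        ∀ x : Ω,
          Summable (fun k => ‖NCFun.evalPoly (p k) x.1‖) ∧
          HasSum (fun k => NCFun.evalPoly (p k) x.1) (F x) ∧
          ∃ V ∈ 𝓝 x, TendstoUniformlyOn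
            (fun (n : ℕ) (y : Ω) => ∑ k ∈ Finset.range n, NCFun.evalPoly (p k) y.1) F atTop V,
      ∀ x : Fin 3 → Ω, ∃ q : ℕ → FreeAlgebra ℂ (Fin d),
        ∀ i, ∃ V ∈ 𝓝 (x i), TendstoUniformlyOn
          (fun (n : ℕ) (y : Ω) => NCFun.evalPoly (q n) y.1) F atTop V] := by
  tfae_have 1 → 2 := by
    intro hF
    rcases Ω.eq_empty_or_nonempty with hempty | hne
    · exact ⟨0, fun k => Submodule.zero_mem _, fun x => absurd x.2 (by simp [hempty])⟩
    classical
    -- The value outside Ω is immaterial: Ω is open and only intertwinings within Ω are used.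
    let G : (Fin d → A) → (H →L[ℂ] H) := fun x => if h : x ∈ Ω then F ⟨x, h⟩ else 0
    have hGF : ∀ x : Ω, G x.1 = F x := fun x => dif_pos x.2
    have hG : NCFun.IntertwinesOn Ω G := by
      intro x hx y hy L h
      rw [hGF ⟨x, hx⟩, hGF ⟨y, hy⟩]
      exact hF.intertwining ⟨x, hx⟩ ⟨y, hy⟩ L h
    have hb : ∀ x ∈ Ω, ∃ C, ∀ᶠ y in 𝓝 x, ‖G y‖ ≤ C := by
      intro x hx
      obtain ⟨V, hV, C, hC⟩ := hF.locallyBounded ⟨x, hx⟩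
      refine ⟨C, ?_⟩
      rw [← map_nhds_subtype_coe_eq_nhds hx (hΩ.isOpen.mem_nhds hx), eventually_map]
      filter_upwards [hV] with y hy
      rw [hGF]
      exact hC y hy
    obtain ⟨p, hp, h⟩ := NCFun.exists_homogeneous_expansion hA hΩ hbal hne hG hb
    refine ⟨p, hp, fun x => ?_⟩
    obtain ⟨u, hu, hux⟩ := h x.1 x.2
    refine ⟨Summable.of_nonneg_of_le (fun _ => norm_nonneg _) hux.self_of_nhds.1 hu,
      hGF x ▸ hux.self_of_nhds.2, _, continuous_subtype_val.continuousAt.eventually hux, ?_⟩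
    refine (tendstoUniformlyOn_tsum_nat hu fun k y hy => hy.1 k).congr_right fun y hy => ?_
    exact hy.2.tsum_eq.trans (hGF y)
  tfae_have 2 → 3 := by
    rintro ⟨p, -, hp⟩ x
    refine ⟨fun n => ∑ k ∈ Finset.range n, p k, fun i => ?_⟩
    obtain ⟨-, -, V, hV, h⟩ := hp (x i)
    refine ⟨V, hV, ?_⟩
    simpa [NCFun.evalPoly] using h
  tfae_have 3 → 1 := by
    refine fun h => ⟨fun x y L hL => ?_, fun x => ?_⟩
    -- Two points suffice, so the third repeats y; both limits must use the same sequence.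
    · obtain ⟨q, hq⟩ := h ![x, y, y]
      obtain ⟨V, hV, hqx⟩ := hq 0
      obtain ⟨W, hW, hqy⟩ := hq 1
      have hx := (hqx.tendsto_at (mem_of_mem_nhds hV)).const_mul L
      have hy := (hqy.tendsto_at (mem_of_mem_nhds hW)).mul_const L
      refine tendsto_nhds_unique hx (hy.congr fun n => ?_)
      exact (NCFun.mul_evalPoly_of_intertwine (q n) x.1 y.1 L hL).symm
    · obtain ⟨q, hq⟩ := h fun _ => x
      obtain ⟨V, hV, hqx⟩ := hq 0
      exact NCFun.exists_norm_le_of_tendstoUniformlyOn hV hqx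
  tfae_finish
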